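/- Let $\mathbb X$ be a Polish space with its Borel $\sigma$-algebra and let $(X_n)_{n\ge1}$ be an exchangeable sequence of $\mathbb X$-valued random variables on a probability space $(\Omega,\mathcal F,\mathbb P)$. Let $\hat F_n=\frac1n\sum_{i=1}^n\delta_{X_i}$ be the empirical distributions and let $\tilde F$ be the directing random measure of the sequence, i.e. the random probability measure on $\mathbb X$ with $\hat F_n\to\tilde F$ weakly, $\mathbb P$-a.s. Let $P_0(\cdot)=\mathbb P(X_1\in\cdot)$ and, for $n\ge1$, let $P_n(\cdot)=\mathbb P(X_{n+1}\in\cdot\mid X_1,\dots,X_n)$ (regular version) be the predictive distributions. Let $\mathbb T\subseteq\mathbb R^k$ be a Borel set, let $\mathcal M$ be a measurable set of probability measures on $\mathbb X$ with $\tilde F\in\mathcal M$ a.s. and $\hat F_n\in\mathcal M$ a.s. for every $n\ge1$, and let $T:\mathcal M\to\mathbb T$ be continuous for the topology of weak convergence. Put $T_n=T(\hat F_n)$ for $n\ge1$, and $\tilde\theta=T(\tilde F)$. Assume: (a) for every $n\ge1$, $T_n$ is predictive sufficient, i.e. $P_n$ is a.s. a measurable function of $T_n$; (b) $q_n(\cdot,t)=\mathbb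 P(X_{n+1}\in\cdot\mid T_n=t)$, $t\in\mathbb T$, $n\ge1$, are regular versions such that, for every Borel set $A$ with $P_0(\partial A)=0$, the functions $t\mapsto q_n(A,t)$ are continuous on $\mathbb T$ uniformly in $t$ and $n$: for every $\varepsilon>0$ there is $\delta>0$ such that $|q_n(A,s)-q_n(A,t)|<\varepsilon$ for all $n\ge1$ and all $s,t\in\mathbb T$ with $|s-t|<\delta$; (i) for some measure $\lambda$ on $\mathbb X$ and every $n\ge0$, a.s. $P_n$ is absolutely continuous with respect to $\lambda$; (ii) a.s., $P_n$ converges to $\tilde F$ in total variation, $\sup_A|P_n(A)-\tilde F(A)|\to0$. Then the statistical model is parametric and dominated by $\lambda$: $T_n\to\tilde\theta$ a.s., and there is a Markov kernel $\theta\mapsto F(\cdot\mid\theta)$ from $\mathbb R^k$ to $\mathbb X$ such that $\tilde F(\cdot)=F(\cdot\mid\tilde\theta)$ a.s. and $F(\cdot\mid\theta)$ is absolutely continuous with respect to $\lambda$ for every $\theta$. -/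

import Mathlib

open MeasureTheory ProbabilityTheory Filter Topology
open scoped ENNReal

namespace PredictiveModel

/-- Observations are indexed from zero: `X i` is the `(i+1)`-st observation. The sequence is
exchangeable if, for every `n`, the joint law of the first `n` observations is invariant under all
permutations of their indices. -/
def Exchangeable {Ω 𝕏 : Type*} [MeasurableSpace Ω] [MeasurableSpace 𝕏]
    (X : ℕ → Ω → 𝕏) (P : Measure Ω) : Prop :=
  ∀ (n : ℕ) (σ : Equiv.Perm (Fin n)),
    P.map (fun ω (i : Fin n) => X (σ i) ω) = P.map (fun ω (i : Fin n) => X i ω)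

/-- The empirical distribution `n⁻¹ ∑_{i < n} δ_{x i}` of the first `n` terms of `x`, for `n ≥ 1`.
(By convention the value at `n = 0`, which is never used, is the one at `n = 1`.) -/
noncomputable def empirical {𝕏 : Type*} [MeasurableSpace 𝕏] (x : ℕ → 𝕏) (n : ℕ) :
    ProbabilityMeasure 𝕏 :=
  ⟨((max n 1 : ℕ) : ℝ≥0∞)⁻¹ • ∑ i ∈ Finset.range (max n 1), Measure.dirac (x i), ⟨by
    have h : ((max n 1 : ℕ) : ℝ≥0∞) ≠ 0 := by
      have : max n 1 ≠ 0 := by omega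
      exact_mod_cast this
    simpa using ENNReal.inv_mul_cancel h (ENNReal.natCast_ne_top _)⟩⟩

/-- The predictive distribution `P_n(·) = P(X_{n+1} ∈ · ∣ X_1, …, X_n)` (regular version), as a
random measure; for `n = 0` the conditioning vector is empty and this is the law of `X_1`. -/
noncomputable def predictive {Ω 𝕏 : Type*} [MeasurableSpace Ω] [MeasurableSpace 𝕏]
    [StandardBorelSpace 𝕏] [Nonempty 𝕏] (X : ℕ → Ω → 𝕏) (P : Measure Ω) [IsFiniteMeasure P]
    (n : ℕ) (ω : Ω) : Measure 𝕏 :=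
  condDistrib (X n) (fun ω' (i : Fin n) => X i ω') P (fun i => X i ω)

/-- `Ft` is the directing random measure of `X`: a random probability measure which is almost
surely the weak limit of the empirical distributions. -/
structure IsDirectingMeasure {Ω 𝕏 : Type*} [MeasurableSpace Ω] [MeasurableSpace 𝕏]
    [TopologicalSpace 𝕏] [OpensMeasurableSpace 𝕏]
    (X : ℕ → Ω → 𝕏) (P : Measure Ω) (Ft : Ω → ProbabilityMeasure 𝕏) : Prop where
  measurable : Measurable Ft
  tendsto : ∀ᵐ ω ∂P, Tendsto (fun n => empirical (fun i => X i ω) n) atTop (𝓝 (Ft ω))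

/-- The statistic `S` is sufficient for the prediction of the observation after the first `n`: the
predictive distribution `P_n` is almost surely a (measurable) function of `S`. -/
def IsPredictiveSufficient {Ω 𝕏 E : Type*} [MeasurableSpace Ω] [MeasurableSpace 𝕏]
    [StandardBorelSpace 𝕏] [Nonempty 𝕏] [MeasurableSpace E] (X : ℕ → Ω → 𝕏) (P : Measure Ω)
    [IsFiniteMeasure P] (n : ℕ) (S : Ω → E) : Prop :=
  ∃ g : Kernel E 𝕏, ∀ᵐ ω ∂P, predictive X P n ω = g (S ω)

/-- The total variation distance `sup_A |μ(A) - ν(A)|` over measurable sets (the supremum is over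
a bounded set for finite measures). -/
noncomputable def tvDistance {𝕏 : Type*} [MeasurableSpace 𝕏] (μ ν : Measure 𝕏) : ℝ :=
  ⨆ A : {A : Set 𝕏 // MeasurableSet A}, |μ.real A - ν.real A|

end PredictiveModel

namespace PredictiveModel

open Set

/-! Sufficiency makes the predictive distribution `q n (S n ω)`, and `S n → T (Ft ω)` by continuity
of `T`. If `A` has `P₀`-null frontier, the continuity of `q n · A`, uniform in `n`, lets the limit
replace `S n`: `Ft ω A = lim q n (T (Ft ω)) A`, a function of `T (Ft ω)`. Such sets form a
generating π-system, so the whole measure is a function of the limit statistic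
(`exists_kernel_comp_of_piSystem`).

Domination goes through `P₀ ≪ lam`. Each `P₀`-null set is a.s. null for `q n (S n ω)`, but with an
exceptional event depending on the set. For closed null sets continuity removes this dependence
(`ae_absolutelyContinuous_of_continuousOn_closed`), and setwise convergence carries `≪ P₀` over to
`Ft ω`. -/

/-- The empirical distribution depends continuously on the observations. -/
theorem continuous_empirical {𝕏 : Type*} [TopologicalSpace 𝕏] [MeasurableSpace 𝕏]
    [OpensMeasurableSpace 𝕏] (n : ℕ) : Continuous fun x : ℕ → 𝕏 => empirical x n := by
  rw [ProbabilityMeasure.continuous_iff_forall_continuous_integral]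
  intro f
  have h : ∀ x : ℕ → 𝕏, ∫ y, f y ∂(empirical x n : Measure 𝕏)
      = (((max n 1 : ℕ) : ℝ≥0∞)⁻¹).toReal • ∑ i ∈ Finset.range (max n 1), f (x i) := by
    intro x
    change ∫ y, f y ∂(((max n 1 : ℕ) : ℝ≥0∞)⁻¹ • ∑ i ∈ Finset.range (max n 1),
      Measure.dirac (x i)) = _
    rw [integral_smul_measure, integral_finsetSum_measure fun i _ => f.integrable _]
    congr 1
    exact Finset.sum_congr rfl fun i _ =>
      integral_dirac' _ _ f.continuous.measurable.stronglyMeasurable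
  simp_rw [h]
  fun_prop

/-- The empirical distribution depends measurably on the observations. -/
theorem measurable_empirical {𝕏 : Type*} [MeasurableSpace 𝕏] (n : ℕ) :
    Measurable fun x : ℕ → 𝕏 => empirical x n := by
  refine Measurable.subtype_mk ?_
  refine Measure.measurable_of_measurable_coe _ fun s hs => ?_
  simp only [Measure.smul_apply, Measure.finsetSum_apply, smul_eq_mul]
  refine Measurable.const_mul (Finset.measurable_sum _ fun i _ => ?_) _
  exact (Measure.measurable_coe hs).comp (Measure.measurable_dirac.comp (measurable_pi_apply i))

/-- The empirical distribution of the first `n ≥ 1` terms depends only on these terms. -/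
theorem empirical_congr {𝕏 : Type*} [MeasurableSpace 𝕏] {n : ℕ} (hn : 1 ≤ n) {x y : ℕ → 𝕏}
    (h : ∀ i < n, x i = y i) : empirical x n = empirical y n := by
  refine Subtype.ext ?_
  change _ • _ = _ • _
  congr 1
  refine Finset.sum_congr rfl fun i hi => ?_
  rw [h i (by simpa [hn] using hi)]

/-- The terms of an exchangeable sequence are identically distributed. -/
theorem Exchangeable.map_eq {Ω 𝕏 : Type*} [MeasurableSpace Ω] [MeasurableSpace 𝕏]
    {X : ℕ → Ω → 𝕏} {P : Measure Ω} (h : Exchangeable X P) (hX : ∀ n, Measurable (X n)) (n : ℕ) :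
    P.map (X n) = P.map (X 0) := by
  have h1 := congrArg (Measure.map fun x : Fin (n + 1) → 𝕏 => x 0)
    (h (n + 1) (Equiv.swap 0 (Fin.last n)))
  rw [Measure.map_map (measurable_pi_apply _) (measurable_pi_lambda _ fun i => hX _),
    Measure.map_map (measurable_pi_apply _) (measurable_pi_lambda _ fun i => hX _)] at h1
  simpa [Function.comp_def] using h1

/-! ### Conditional laws given a sufficient statistic. -/

/-- A kernel whose restriction to a conull set is Markov can be replaced by a Markov kernel. -/
theorem exists_isMarkovKernel_of_ae {Ω E 𝕏 : Type*} [MeasurableSpace Ω] [MeasurableSpace E]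
    [MeasurableSpace 𝕏] [Nonempty 𝕏] {P : Measure Ω} {S : Ω → E} (g : Kernel E 𝕏)
    (h : ∀ᵐ ω ∂P, IsProbabilityMeasure (g (S ω))) :
    ∃ g' : Kernel E 𝕏, IsMarkovKernel g' ∧ ∀ᵐ ω ∂P, g' (S ω) = g (S ω) := by
  classical
  have hG : MeasurableSet {t | g t univ = 1} :=
    g.measurable_coe MeasurableSet.univ (measurableSet_singleton 1)
  refine ⟨Kernel.piecewise hG g (Kernel.const E (Measure.dirac (Classical.arbitrary 𝕏))),
    ⟨fun t => ?_⟩, ?_⟩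
  · rw [Kernel.piecewise_apply]
    split_ifs with ht
    · exact ⟨ht⟩
    · rw [Kernel.const_apply]; infer_instance
  · filter_upwards [h] with ω hω
    exact (Kernel.piecewise_apply ..).trans (if_pos hω.measure_univ)

/-- If the conditional law of `Y` given `W` is a function of a statistic `S` of `W`, then it is
the conditional law of `Y` given `S`. -/
theorem condDistrib_eq_of_sufficient {Ω 𝕏 β E : Type*} [MeasurableSpace Ω] [MeasurableSpace 𝕏]
    [StandardBorelSpace 𝕏] [Nonempty 𝕏] [MeasurableSpace β] [MeasurableSpace E] {P : Measure Ω}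
    [IsProbabilityMeasure P] {Y : Ω → 𝕏} {W : Ω → β} {S : Ω → E} {h : β → E}
    (hY : Measurable Y) (hW : Measurable W) (hh : Measurable h) (hS : ∀ᵐ ω ∂P, S ω = h (W ω))
    (g : Kernel E 𝕏) (hg : ∀ᵐ ω ∂P, condDistrib Y W P (W ω) = g (S ω))
    (q : Kernel E 𝕏) [IsMarkovKernel q] (hq : HasCondDistrib Y S q P) :
    ∀ᵐ ω ∂P, condDistrib Y W P (W ω) = q (S ω) := by
  -- `g` is an arbitrary kernel, while uniqueness of conditional laws needs a finite one.
  obtain ⟨g', hg', hgg'⟩ := exists_isMarkovKernel_of_ae (P := P) (S := S) g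
    (by filter_upwards [hg] with ω hω; rw [← hω]; infer_instance)
  have hκ : ∀ᵐ ω ∂P, condDistrib Y W P (W ω) = g' (h (W ω)) := by
    filter_upwards [hg, hgg', hS] with ω h1 h2 h3
    rw [h1, ← h2, h3]
  -- Events of `S` are, up to null sets, events of `W`, so the disintegration over `W` can be
  -- integrated over them.
  have hlaw : P.map (fun ω => (S ω, Y ω)) = P.map S ⊗ₘ g' := by
    rw [Measure.map_congr hS, Measure.map_congr (hS.mono fun ω hω => congrArg (·, Y ω) hω :
      (fun ω => (S ω, Y ω)) =ᵐ[P] fun ω => (h (W ω), Y ω))]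
    have : IsProbabilityMeasure (P.map fun ω => (h (W ω), Y ω)) :=
      Measure.isProbabilityMeasure_map (by fun_prop)
    refine Measure.ext_prod fun {B A} hB hA => ?_
    rw [Measure.compProd_apply_prod hB hA, setLIntegral_map hB (g'.measurable_coe hA) (by fun_prop),
      Measure.map_apply (by fun_prop) (hB.prod hA)]
    have h1 := setLIntegral_preimage_condDistrib (μ := P) hW hY.aemeasurable hA (hh hB)
    rw [setLIntegral_congr_fun_ae (g := fun ω => g' (h (W ω)) A) (hW (hh hB))
      (hκ.mono fun ω hω _ => by rw [hω])] at h1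
    exact h1.symm
  have h2 : g' =ᵐ[P.map S] q :=
    (condDistrib_ae_eq_of_measure_eq_compProd S hY.aemeasurable hlaw).symm.trans
      (condDistrib_ae_eq_of_measure_eq_compProd S hY.aemeasurable hq.map_eq)
  have h3 := ae_of_ae_map hq.aemeasurable_fst h2
  filter_upwards [hκ, h3, hS] with ω h4 h5 h6
  rw [h4, ← h6, h5]

/-! ### Continuity sets and factorization of a random measure. -/

/-- The continuity sets of a finite measure generate the Borel σ-algebra. -/
theorem generateFrom_null_frontier {𝕏 : Type*} [TopologicalSpace 𝕏]
    [TopologicalSpace.PseudoMetrizableSpace 𝕏] [mX : MeasurableSpace 𝕏] [BorelSpace 𝕏]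
    (μ : Measure 𝕏) [IsFiniteMeasure μ] :
    mX = MeasurableSpace.generateFrom {A : Set 𝕏 | MeasurableSet A ∧ μ (frontier A) = 0} := by
  let := TopologicalSpace.pseudoMetrizableSpacePseudoMetric 𝕏
  refine le_antisymm ?_ (MeasurableSpace.generateFrom_le fun A hA => hA.1)
  conv_lhs => rw [BorelSpace.measurable_eq (α := 𝕏), borel_eq_generateFrom_isClosed]
  refine MeasurableSpace.generateFrom_le fun K hK => ?_
  -- Frontiers of thickenings with distinct radii are disjoint, so all but countably many radii are
  -- admissible.
  obtain ⟨r, hr, hr'⟩ := exists_null_frontiers_thickening μ K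
  have hKr : K = ⋂ n, Metric.thickening (r n) K := by
    refine Subset.antisymm (subset_iInter fun n => Metric.self_subset_thickening (hr' n).1 K) ?_
    intro x hx
    rw [← (show IsClosed K from hK).closure_eq]
    rw [mem_iInter] at hx
    rw [Metric.mem_closure_iff]
    intro ε hε
    obtain ⟨n, hn⟩ := (hr.eventually (gt_mem_nhds hε)).exists
    obtain ⟨z, hz, hxz⟩ := Metric.mem_thickening_iff.1 (hx n)
    exact ⟨z, hz, hxz.trans hn⟩
  rw [hKr]
  exact MeasurableSet.iInter fun n => MeasurableSpace.measurableSet_generateFrom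
    ⟨Metric.isOpen_thickening.measurableSet, (hr' n).2⟩

/-- The continuity sets of a measure form a π-system. -/
theorem isPiSystem_null_frontier {𝕏 : Type*} [TopologicalSpace 𝕏] [MeasurableSpace 𝕏]
    (μ : Measure 𝕏) :
    IsPiSystem {A : Set 𝕏 | MeasurableSet A ∧ μ (frontier A) = 0} := by
  rintro A ⟨hA, hA'⟩ B ⟨hB, hB'⟩ -
  refine ⟨hA.inter hB, measure_mono_null (frontier_inter_subset A B) ?_⟩
  exact measure_union_null (measure_mono_null inter_subset_left hA')
    (measure_mono_null inter_subset_right hB')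

/-- A random probability measure whose values on a generating π-system are functions of `θ` is
itself a function of `θ`. -/
theorem exists_kernel_comp_of_piSystem {Ω 𝕏 E : Type*} [MeasurableSpace Ω] [mX : MeasurableSpace 𝕏]
    [StandardBorelSpace 𝕏] [Nonempty 𝕏] [MeasurableSpace E] {P : Measure Ω}
    [IsProbabilityMeasure P] (κ : Kernel Ω 𝕏) [IsMarkovKernel κ] {θ : Ω → E} (hθ : Measurable θ)
    {C : Set (Set 𝕏)} (hgen : mX = MeasurableSpace.generateFrom C) (hpi : IsPiSystem C)
    (hC : ∀ A ∈ C, ∃ φ : E → ℝ≥0∞, Measurable φ ∧ ∀ᵐ ω ∂P, κ ω A = φ (θ ω)) :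
    ∃ F : Kernel E 𝕏, IsMarkovKernel F ∧ ∀ᵐ ω ∂P, κ ω = F (θ ω) := by
  -- The joint law of `θ` and a point drawn from `κ`; its conditional kernel given `θ` is the
  -- candidate.
  set ν : Measure (E × 𝕏) := (P ⊗ₘ κ).map (Prod.map θ id) with hν
  have : IsProbabilityMeasure ν := Measure.isProbabilityMeasure_map (by fun_prop)
  have hfst : ν.fst = P.map θ := by
    rw [hν, Measure.fst, Measure.map_map measurable_fst (by fun_prop)]
    conv_rhs => rw [← Measure.fst_compProd P κ, Measure.fst, Measure.map_map hθ measurable_fst]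
    rfl
  have hdis : P.map θ ⊗ₘ ν.condKernel = ν := by rw [← hfst]; exact ν.disintegrate _
  have hθF : ∀ A : Set 𝕏, MeasurableSet A → ∀ᵐ ω ∂P, κ ω A = ν.condKernel (θ ω) A := by
    intro A hA
    induction A, hA using MeasurableSpace.induction_on_inter hgen hpi with
    | empty => simp
    | basic A hAC =>
      have hA : MeasurableSet A := by
        rw [hgen]; exact MeasurableSpace.measurableSet_generateFrom hAC
      obtain ⟨φ, hφ, hφκ⟩ := hC A hAC
      have h1 : (fun t => ν.condKernel t A) =ᵐ[P.map θ] φ := by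
        refine ae_eq_of_forall_setLIntegral_eq_of_sigmaFinite
          (ν.condKernel.measurable_coe hA) hφ fun B hB _ => ?_
        rw [← Measure.compProd_apply_prod hB hA, hdis, hν,
          Measure.map_apply (by fun_prop) (hB.prod hA), setLIntegral_map hB hφ hθ]
        rw [show Prod.map θ id ⁻¹' B ×ˢ A = (θ ⁻¹' B) ×ˢ A from rfl,
          Measure.compProd_apply_prod (hθ hB) hA]
        exact setLIntegral_congr_fun_ae (hθ hB) (hφκ.mono fun ω h _ => h)
      filter_upwards [hφκ, ae_of_ae_map hθ.aemeasurable h1] with ω h2 h3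
      rw [h2, h3]
    | compl A hA ih =>
      filter_upwards [ih] with ω h
      rw [prob_compl_eq_one_sub hA, prob_compl_eq_one_sub hA, h]
    | iUnion f hd hf ih =>
      filter_upwards [ae_all_iff.2 ih] with ω h
      rw [measure_iUnion hd hf, measure_iUnion hd hf]
      exact tsum_congr h
  refine ⟨ν.condKernel, inferInstance, ?_⟩
  -- The null set in `hθF` depends on `A`; comparing joint laws yields a single one.
  refine Kernel.ae_eq_of_compProd_eq (η := ν.condKernel.comap θ hθ) ?_
  refine Measure.ext_prod fun {B A} hB hA => ?_
  rw [Measure.compProd_apply_prod hB hA, Measure.compProd_apply_prod hB hA]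
  exact setLIntegral_congr_fun_ae hB ((hθF A hA).mono fun ω h _ => h)

/-! ### Domination, and measurability of the statistic. -/

/-- If the values of a Markov kernel on `μ`-null closed sets are continuous in the parameter and
null in the mean, then almost every value of the kernel is absolutely continuous with respect
to `μ`. -/
theorem ae_absolutelyContinuous_of_continuousOn_closed {𝕏 E : Type*} [TopologicalSpace 𝕏]
    [TopologicalSpace.PseudoMetrizableSpace 𝕏] [MeasurableSpace 𝕏] [BorelSpace 𝕏]
    [TopologicalSpace E] [SecondCountableTopology E] [MeasurableSpace E] {ν : Measure E}
    {μ : Measure 𝕏} {D : Set E} (hD : ∀ᵐ t ∂ν, t ∈ D) (q : Kernel E 𝕏) [IsMarkovKernel q]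
    (hcont : ∀ K : Set 𝕏, IsClosed K → μ K = 0 → ContinuousOn (fun t => (q t).real K) D)
    (hnull : ∀ K : Set 𝕏, IsClosed K → μ K = 0 → ∀ᵐ t ∂ν, q t K = 0) :
    ∀ᵐ t ∂ν, q t ≪ μ := by
  filter_upwards [hD, Measure.support_mem_ae (μ := ν)] with t htD htν
  refine Measure.AbsolutelyContinuous.mk fun A hA hμA => ?_
  -- Inner regularity leaves closed null sets, the only ones where continuity is available.
  rw [hA.measure_eq_iSup_isClosed_of_ne_top (measure_ne_top _ _)]
  simp only [ENNReal.iSup_eq_zero]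
  intro K hKA hK
  have hμK := measure_mono_null hKA hμA
  by_contra hne
  have hpos : 0 < (q t).real K :=
    ENNReal.toReal_pos hne (measure_ne_top _ _)
  -- Positivity at `t` would spread to a neighbourhood in `D`, which is charged by `ν` because `t`
  -- lies in the support.
  have hev := (hcont K hK hμK t htD).eventually (lt_mem_nhds hpos)
  obtain ⟨U, hU, hUD⟩ := mem_nhdsWithin_iff_exists_mem_nhds_inter.1 hev
  have hUpos := (Measure.mem_support_iff_forall t).1 htν U hU
  refine hUpos.ne' (measure_mono_null (t := {s | ¬ (s ∈ D ∧ q s K = 0)}) ?_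
    (hD.and (hnull K hK hμK)))
  rintro s hsU ⟨hsD, hs⟩
  have h0 : 0 < (q s).real K := hUD ⟨hsU, hsD⟩
  simp [Measure.real, hs] at h0

/-- Convergence in total variation implies convergence of the measures of all sets. -/
theorem tendsto_measure_of_tvDistance {𝕏 : Type*} [MeasurableSpace 𝕏] {μ : ℕ → Measure 𝕏}
    [∀ n, IsProbabilityMeasure (μ n)] {ν : Measure 𝕏} [IsProbabilityMeasure ν]
    (h : Tendsto (fun n => tvDistance (μ n) ν) atTop (𝓝 0)) {A : Set 𝕏} (hA : MeasurableSet A) :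
    Tendsto (fun n => (μ n).real A) atTop (𝓝 (ν.real A)) := by
  rw [tendsto_iff_dist_tendsto_zero]
  refine squeeze_zero (fun _ => dist_nonneg) (fun n => ?_) h
  refine le_ciSup (f := fun A : {A : Set 𝕏 // MeasurableSet A} =>
    |(μ n).real A - ν.real A|) ⟨1, ?_⟩ ⟨A, hA⟩
  rintro _ ⟨B, rfl⟩
  exact abs_sub_le_of_nonneg_of_le measureReal_nonneg measureReal_le_one measureReal_nonneg
    measureReal_le_one

/-- A statistic that is continuous on a measurable set of measures is, at the empirical
distributions of this set, a measurable function of the observations. -/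
theorem exists_measurable_statistic {𝕏 E : Type*} [TopologicalSpace 𝕏] [SecondCountableTopology 𝕏]
    [MeasurableSpace 𝕏] [BorelSpace 𝕏] [Nonempty 𝕏] [TopologicalSpace E] [MeasurableSpace E]
    [BorelSpace E] [Nonempty E] {M : Set (ProbabilityMeasure 𝕏)} (hM : MeasurableSet M)
    {T : ProbabilityMeasure 𝕏 → E} (hT : ContinuousOn T M) {n : ℕ} (hn : 1 ≤ n) :
    ∃ h : (Fin n → 𝕏) → E, Measurable h ∧
      ∀ x : ℕ → 𝕏, empirical x n ∈ M → T (empirical x n) = h fun i => x i := by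
  classical
  -- Padding by the first entry; the empirical distribution of order `n` ignores it.
  let e : (Fin n → 𝕏) → ℕ → 𝕏 := fun x i => x (if h : i < n then ⟨i, h⟩ else ⟨0, hn⟩)
  have he : Continuous e := continuous_pi fun i => continuous_apply _
  have hD : MeasurableSet ((fun x => empirical (e x) n) ⁻¹' M) :=
    ((measurable_empirical n).comp he.measurable) hM
  refine ⟨((fun x => empirical (e x) n) ⁻¹' M).piecewise (fun x => T (empirical (e x) n))
    (fun _ => Classical.arbitrary E), ?_, fun x hx => ?_⟩
  · refine ContinuousOn.measurable_piecewise ?_ continuousOn_const hD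
    exact hT.comp ((continuous_empirical n).comp he).continuousOn (fun x hx => hx)
  · have hex : empirical (e fun i => x i) n = empirical x n :=
      empirical_congr hn fun i hi => by simp [e, hi]
    have hmem : (fun i : Fin n => x i) ∈ (fun x => empirical (e x) n) ⁻¹' M := by
      rwa [mem_preimage, hex]
    rw [piecewise_eq_of_mem _ _ _ hmem, hex]

/-- If the predictive distributions are almost surely dominated by `lam`, then so is the marginal
law of the next observation. -/
theorem map_absolutelyContinuous_of_predictive {Ω 𝕏 : Type*} [MeasurableSpace Ω]
    [MeasurableSpace 𝕏] [StandardBorelSpace 𝕏] [Nonempty 𝕏] {X : ℕ → Ω → 𝕏}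
    (hX : ∀ n, Measurable (X n)) {P : Measure Ω} [IsProbabilityMeasure P] {lam : Measure 𝕏} {n : ℕ}
    (h : ∀ᵐ ω ∂P, predictive X P n ω ≪ lam) : P.map (X n) ≪ lam := by
  refine Measure.AbsolutelyContinuous.mk fun A hA hlam => ?_
  have h1 := setLIntegral_preimage_condDistrib (μ := P) (Y := X n)
    (X := fun ω (i : Fin n) => X i ω) (measurable_pi_lambda _ fun i => hX i) (hX n).aemeasurable
    hA MeasurableSet.univ
  rw [preimage_univ, univ_inter, Measure.restrict_univ, ← Measure.map_apply (hX n) hA] at h1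
  rw [← h1]
  exact lintegral_eq_zero_of_ae_eq_zero (h.mono fun ω hω => hω hlam)

/-- A Markov kernel that is almost surely dominated by `μ` along `θ` can be replaced by one that is
dominated by `μ` everywhere. -/
theorem exists_absolutelyContinuous_kernel {Ω 𝕏 E : Type*} [MeasurableSpace Ω] [MeasurableSpace 𝕏]
    [MeasurableSpace.CountablyGenerated 𝕏] [MeasurableSpace E] {P : Measure Ω} (μ : Measure 𝕏)
    [IsProbabilityMeasure μ] {θ : Ω → E} (F : Kernel E 𝕏) [IsMarkovKernel F]
    (h : ∀ᵐ ω ∂P, F (θ ω) ≪ μ) :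
    ∃ F' : Kernel E 𝕏, IsMarkovKernel F' ∧ (∀ᵐ ω ∂P, F' (θ ω) = F (θ ω)) ∧ ∀ t, F' t ≪ μ := by
  classical
  -- Measurability here uses finite kernels, hence a probability `μ` rather than `lam`.
  have hG : MeasurableSet {t | F t ≪ μ} :=
    Kernel.measurableSet_absolutelyContinuous F (Kernel.const E μ)
  refine ⟨Kernel.piecewise hG F (Kernel.const E μ), inferInstance, ?_, fun t => ?_⟩
  · filter_upwards [h] with ω hω
    exact (Kernel.piecewise_apply ..).trans (if_pos hω)
  · rw [Kernel.piecewise_apply]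
    split_ifs with ht
    · exact ht
    · rw [Kernel.const_apply]

end PredictiveModel

/-! ### The main theorem. -/

theorem mainTheorem8
    {Ω 𝕏 : Type*} [MeasurableSpace Ω] (P : Measure Ω) [IsProbabilityMeasure P]
    [TopologicalSpace 𝕏] [PolishSpace 𝕏] [MeasurableSpace 𝕏] [BorelSpace 𝕏] [Nonempty 𝕏]
    -- the exchangeable sequence and its directing random measure
    (X : ℕ → Ω → 𝕏) (hX : ∀ n, Measurable (X n))
    (hexch : PredictiveModel.Exchangeable X P)
    (Ft : Ω → ProbabilityMeasure 𝕏) (hFt : PredictiveModel.IsDirectingMeasure X P Ft)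
    -- the statistic `T : M → 𝕋`, continuous for the topology of weak convergence
    (k : ℕ) (𝕋 : Set (EuclideanSpace ℝ (Fin k))) (h𝕋 : MeasurableSet 𝕋)
    (M : Set (ProbabilityMeasure 𝕏)) (hM : MeasurableSet M)
    (T : ProbabilityMeasure 𝕏 → EuclideanSpace ℝ (Fin k))
    (hTM : Set.MapsTo T M 𝕋) (hTcont : ContinuousOn T M)
    (hFtM : ∀ᵐ ω ∂P, Ft ω ∈ M)
    -- `T_n = T(F̂_n)` is defined and is sufficient for prediction
    (hempM : ∀ n, 1 ≤ n → ∀ᵐ ω ∂P, PredictiveModel.empirical (fun i => X i ω) n ∈ M)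
    (hsuff : ∀ n, 1 ≤ n → PredictiveModel.IsPredictiveSufficient X P n
      (fun ω => T (PredictiveModel.empirical (fun i => X i ω) n)))
    -- `q_n(·, t) = P(X_{n+1} ∈ · ∣ T_n = t)`, with the uniform continuity condition on `𝕋`
    (q : ℕ → Kernel (EuclideanSpace ℝ (Fin k)) 𝕏) [∀ n, IsMarkovKernel (q n)]
    (hq : ∀ n, 1 ≤ n → HasCondDistrib (X n)
      (fun ω => T (PredictiveModel.empirical (fun i => X i ω) n)) (q n) P)
    (hqcont : ∀ A : Set 𝕏, MeasurableSet A → P.map (X 0) (frontier A) = 0 →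
      ∀ ε : ℝ, 0 < ε → ∃ δ : ℝ, 0 < δ ∧ ∀ n, 1 ≤ n → ∀ s ∈ 𝕋, ∀ t ∈ 𝕋, dist s t < δ →
        |(q n s).real A - (q n t).real A| < ε)
    -- i) the predictive distributions are absolutely continuous with respect to `lam`
    (lam : Measure 𝕏)
    (hac : ∀ n, ∀ᵐ ω ∂P, PredictiveModel.predictive X P n ω ≪ lam)
    -- ii) they converge almost surely to the directing measure in total variation
    (htv : ∀ᵐ ω ∂P, Tendsto
      (fun n => PredictiveModel.tvDistance (PredictiveModel.predictive X P n ω)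
        (Ft ω : Measure 𝕏)) atTop (𝓝 0)) :
    ∃ F : Kernel (EuclideanSpace ℝ (Fin k)) 𝕏, IsMarkovKernel F ∧
      (∀ᵐ ω ∂P, Tendsto (fun n => T (PredictiveModel.empirical (fun i => X i ω) n))
        atTop (𝓝 (T (Ft ω)))) ∧
      (∀ᵐ ω ∂P, (Ft ω : Measure 𝕏) = F (T (Ft ω))) ∧
      ∀ θ, F θ ≪ lam := by
  let S : ℕ → Ω → EuclideanSpace ℝ (Fin k) := fun n ω => T (PredictiveModel.empirical (fun i => X i ω) n)
  let P₀ : Measure 𝕏 := P.map (X 0)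
  have hP₀ : IsProbabilityMeasure P₀ := Measure.isProbabilityMeasure_map (hX 0).aemeasurable
  have hP₀lam : P₀ ≪ lam := PredictiveModel.map_absolutelyContinuous_of_predictive hX (hac 0)
  -- the statistics converge
  have hempM' : ∀ᵐ ω ∂P, ∀ n, 1 ≤ n → PredictiveModel.empirical (fun i => X i ω) n ∈ M :=
    ae_all_iff.2 fun n => ae_all_iff.2 fun hn => hempM n hn
  have hS : ∀ᵐ ω ∂P, Tendsto (fun n => S n ω) atTop (𝓝 (T (Ft ω))) := by
    filter_upwards [hempM', hFt.tendsto, hFtM] with ω h1 h2 h3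
    exact (hTcont _ h3).tendsto.comp (tendsto_nhdsWithin_iff.2 ⟨h2,
      (eventually_ge_atTop 1).mono fun n hn => h1 n hn⟩)
  have hSmeas : ∀ n, 1 ≤ n → AEMeasurable (S n) P := fun n hn => (hq n hn).aemeasurable_fst
  have hθ : AEMeasurable (fun ω => T (Ft ω)) P :=
    -- The shift avoids `S 0`, whose measurability is not known.
    aemeasurable_of_tendsto_metrizable_ae atTop (f := fun n => S (n + 1))
      (fun n => hSmeas _ (by omega)) (hS.mono fun ω h => h.comp (tendsto_add_atTop_nat 1))
  -- the predictive distributions are the kernels `q n` at the statistics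
  have hpred : ∀ᵐ ω ∂P, ∀ n, 1 ≤ n → PredictiveModel.predictive X P n ω = q n (S n ω) := by
    refine ae_all_iff.2 fun n => ae_all_iff.2 fun hn => ?_
    obtain ⟨h, hh, hhT⟩ := PredictiveModel.exists_measurable_statistic hM hTcont hn
    obtain ⟨g, hg⟩ := hsuff n hn
    exact PredictiveModel.condDistrib_eq_of_sufficient
      (W := fun ω (i : Fin n) => X i ω) (S := S n) (hX n) (measurable_pi_lambda _ fun i => hX i) hh
      ((hempM n hn).mono fun ω hω => hhT _ hω) g hg (q n) (hq n hn)
  have hconv : ∀ᵐ ω ∂P, ∀ A, MeasurableSet A →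
      Tendsto (fun n => (q n (S n ω)).real A) atTop (𝓝 ((Ft ω : Measure 𝕏).real A)) := by
    filter_upwards [hpred, htv] with ω h1 h2 A hA
    have : ∀ n, IsProbabilityMeasure (PredictiveModel.predictive X P n ω) := fun n => by
      unfold PredictiveModel.predictive; infer_instance
    refine (PredictiveModel.tendsto_measure_of_tvDistance h2 hA).congr' ?_
    filter_upwards [eventually_ge_atTop 1] with n hn
    rw [h1 n hn]
  -- the directing measure is dominated by the law of one observation
  have hqac : ∀ᵐ ω ∂P, ∀ n, 1 ≤ n → q n (S n ω) ≪ P₀ := by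
    refine ae_all_iff.2 fun n => ae_all_iff.2 fun hn => ?_
    have hfront : ∀ K : Set 𝕏, IsClosed K → P₀ K = 0 → P₀ (frontier K) = 0 := fun K hK h =>
      measure_mono_null hK.frontier_subset h
    refine ae_of_ae_map (hSmeas n hn)
      (PredictiveModel.ae_absolutelyContinuous_of_continuousOn_closed (D := 𝕋) ?_ (q n) ?_ ?_)
    · exact (ae_map_iff (hSmeas n hn) h𝕋).2 ((hempM n hn).mono fun ω hω => hTM hω)
    · intro K hK hK0
      rw [Metric.continuousOn_iff]
      intro t ht ε hε
      obtain ⟨δ, hδ, h⟩ := hqcont K hK.measurableSet (hfront K hK hK0) ε hε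
      exact ⟨δ, hδ, fun s hs hst => h n hn s hs t ht hst⟩
    · intro K hK hK0
      -- The mean of `q n · K` under the law of `S n` is the law of `X n` at `K`, which is `P₀ K` by
      -- exchangeability.
      have h1 : (P.map (S n) ⊗ₘ q n) (Set.univ ×ˢ K) = 0 := by
        rw [← (hq n hn).map_eq, Measure.map_apply_of_aemeasurable (hq n hn).aemeasurable
          (MeasurableSet.univ.prod hK.measurableSet), Set.univ_prod,
          ← Set.preimage_comp]
        rwa [show P₀ = P.map (X n) from (hexch.map_eq hX n).symm,
          Measure.map_apply (hX n) hK.measurableSet] at hK0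
      rw [Measure.compProd_apply_prod MeasurableSet.univ hK.measurableSet, Measure.restrict_univ,
        lintegral_eq_zero_iff ((q n).measurable_coe hK.measurableSet)] at h1
      exact h1
  have hFtac : ∀ᵐ ω ∂P, (Ft ω : Measure 𝕏) ≪ P₀ := by
    filter_upwards [hqac, hconv] with ω h1 h2
    refine Measure.AbsolutelyContinuous.mk fun A hA hA0 => ?_
    have h3 : (Ft ω : Measure 𝕏).real A = 0 := by
      refine tendsto_nhds_unique ((h2 A hA).congr' ?_) tendsto_const_nhds
      filter_upwards [eventually_ge_atTop 1] with n hn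
      rw [Measure.real, h1 n hn hA0, ENNReal.toReal_zero]
    exact (measureReal_eq_zero_iff).1 h3
  -- the directing measure is a function of the limit statistic
  obtain ⟨θ, hθm, hθeq⟩ := hθ
  let κ : Kernel Ω 𝕏 := ⟨fun ω => (Ft ω : Measure 𝕏), measurable_subtype_coe.comp hFt.measurable⟩
  have hκ : IsMarkovKernel κ := ⟨fun ω => (Ft ω).2⟩
  obtain ⟨F, hF, hFκ⟩ := PredictiveModel.exists_kernel_comp_of_piSystem (P := P) κ hθm
    (PredictiveModel.generateFrom_null_frontier P₀) (PredictiveModel.isPiSystem_null_frontier P₀) (by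
      rintro A ⟨hA, hA0⟩
      -- A `limsup` is measurable in `t` even where `q n t A` fails to converge.
      refine ⟨fun t => limsup (fun n => q n t A) atTop,
        Measurable.limsup fun n => (q n).measurable_coe hA, ?_⟩
      filter_upwards [hconv, hS, hempM', hFtM, hθeq] with ω h1 h2 h3 h4 h5
      refine (Tendsto.limsup_eq ?_).symm
      rw [← ENNReal.tendsto_toReal_iff (fun n => measure_ne_top _ _) (measure_ne_top _ _), ← h5]
      -- Kernel and argument both vary with `n`, so `δ` must not depend on `n`.
      have h6 : Tendsto (fun n => (q n (T (Ft ω))).real A - (q n (S n ω)).real A) atTop (𝓝 0) := by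
        rw [Metric.tendsto_atTop]
        intro ε hε
        obtain ⟨δ, hδ, h⟩ := hqcont A hA hA0 ε hε
        obtain ⟨N, hN⟩ := Metric.tendsto_atTop.1 h2 δ hδ
        refine ⟨max N 1, fun n hn => ?_⟩
        have hn1 : 1 ≤ n := (le_max_right _ _).trans hn
        rw [Real.dist_0_eq_abs]
        exact h n hn1 _ (hTM h4) _ (hTM (h3 n hn1))
          (by rw [dist_comm]; exact hN n ((le_max_left _ _).trans hn))
      simpa using! h6.add (h1 A hA))
  have hFFt : ∀ᵐ ω ∂P, (Ft ω : Measure 𝕏) = F (T (Ft ω)) := by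
    filter_upwards [hFκ, hθeq] with ω h1 h2
    rw [h2]; exact h1
  obtain ⟨F', hF', hF'F, hF'ac⟩ := PredictiveModel.exists_absolutelyContinuous_kernel (P := P) P₀
    (θ := fun ω => T (Ft ω)) F (by filter_upwards [hFFt, hFtac] with ω h1 h2; rwa [← h1])
  refine ⟨F', hF', hS, ?_, fun t => (hF'ac t).trans hP₀lam⟩
  filter_upwards [hFFt, hF'F] with ω h1 h2
  rw [h2, ← h1]
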